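/- For integers $m,n\ge 0$ let $[m]^n(123)$ be the set of words $w_1\cdots w_n$ with letters in $[m]=\{1,\dots,m\}$ that avoid the pattern $123$, i.e. for which there are no positions $a<b<c$ with $w_a<w_b<w_c$. Let $C_i=\frac1{i+1}\binom{2i}{i}$ be the Catalan numbers and $C(z)=\sum_{i\ge0}C_iz^i$. Then for all $n,k\ge 0$ $$|[k+2]^n(123)|=\sum_{r=0}^{n}\sum_{i=0}^{k}2^{n-r}\,C_i\binom{i}{r-i}\binom nr\binom ki ,$$ where $\binom{i}{j}=0$ for $j<0$. Let $K$ be any field of characteristic $0$. The generating function $$F(x,y)=\sum_{n,k\ge0}|[k+2]^n(123)|\,x^ky^n\in K[[x,y]]$$ is given by $$F(x,y)=\frac{1}{(1-x)(1-2y)}\;C\!\left(\frac{xy(1-y)}{(1-x)(1-2y)^2}\right).$$ Equivalently, $F$ is algebraic of degree $2$ over $K(x,y)$ (its minimal polynomial over $K(x,y)$ has degree $2$) and satisfies $$x(1-x)y(1-y)F^2-(1-x)(1-2y)F+1=0 .$$ The equivalence means that a power series $G\in K[[x,y]]$ satisfies $x(1-x)y(1-y)G^2-(1-x)(1-2y)G+1=0$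 if and only if $G=\frac{1}{(1-x)(1-2y)}\,C\!\left(\frac{xy(1-y)}{(1-x)(1-2y)^2}\right)$. -/

import Mathlib

namespace WordPatterns

/-- The word `w = w₁ ⋯ wₛ` contains the pattern `v = v₁ ⋯ vᵣ`: there are positions
`t₁ < ⋯ < tᵣ` in `w` such that `w_{tᵢ} ≤ w_{tⱼ}` if and only if `vᵢ ≤ vⱼ`, for all `i, j`. -/
def Contains {α β : Type*} [LE α] [LE β] {s r : ℕ} (w : Fin s → α) (v : Fin r → β) : Prop :=
  ∃ t : Fin r → Fin s, StrictMono t ∧ ∀ i j : Fin r, w (t i) ≤ w (t j) ↔ v i ≤ v j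

/-- The set `[k]ⁿ(v)` of words of length `n` over the `k`-letter ordered alphabet `Fin k`
that avoid the pattern `v`. -/
def avoiders (k n : ℕ) {β : Type*} [LE β] {r : ℕ} (v : Fin r → β) : Set (Fin n → Fin k) :=
  {w | ¬ Contains w v}

/-- The pattern `123`. -/
def p123 : Fin 3 → ℕ := ![1, 2, 3]

section Series

variable (K : Type*) [Field K]

/-- The variable `x` of `K⟦x, y⟧`. -/
noncomputable abbrev x : MvPowerSeries (Fin 2) K := MvPowerSeries.X 0

/-- The variable `y` of `K⟦x, y⟧`. -/
noncomputable abbrev y : MvPowerSeries (Fin 2) K := MvPowerSeries.X 1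

/-- The generating function `F(x, y) = ∑_{n,k} |[k+2]ⁿ(123)| xᵏ yⁿ`: the coefficient at a
monomial `m` (which is `x ^ m 0 * y ^ m 1`) is the number for `k = m 0` and `n = m 1`. -/
noncomputable def F : MvPowerSeries (Fin 2) K :=
  fun m => ((avoiders (m 0 + 2) (m 1) p123).ncard : K)

/-- The Catalan generating function `C(z) = ∑ᵢ Cᵢ zⁱ` with coefficients in `K`. -/
noncomputable def catalanGF : PowerSeries K := PowerSeries.mk fun i => (catalan i : K)

/-- The series `x y (1 - y) / ((1 - x) (1 - 2 y) ^ 2)`. -/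
noncomputable def catalanArg : MvPowerSeries (Fin 2) K :=
  x K * y K * (1 - y K) * ((1 - x K) * (1 - 2 * y K) ^ 2)⁻¹

/-- `catalanArg` has no constant term, so it can be substituted into any power series. -/
theorem hasSubst_catalanArg : PowerSeries.HasSubst (catalanArg K) := by
  apply PowerSeries.HasSubst.of_constantCoeff_zero
  simp [catalanArg]

/-- The series `1 / ((1 - x) (1 - 2 y)) * C(x y (1 - y) / ((1 - x) (1 - 2 y) ^ 2))`, the value of
`C` being the formal substitution of power series. -/
noncomputable def closedForm : MvPowerSeries (Fin 2) K :=
  ((1 - x K) * (1 - 2 * y K))⁻¹ * (catalanGF K).subst (catalanArg K)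

instance faithfulSMul_fractionRing :
    FaithfulSMul (MvPolynomial (Fin 2) K) (FractionRing (MvPowerSeries (Fin 2) K)) := by
  rw [faithfulSMul_iff_algebraMap_injective,
    IsScalarTower.algebraMap_eq (MvPolynomial (Fin 2) K) (MvPowerSeries (Fin 2) K), RingHom.coe_comp]
  refine (IsFractionRing.injective (MvPowerSeries (Fin 2) K)
    (FractionRing (MvPowerSeries (Fin 2) K))).comp ?_
  intro p q h
  exact MvPolynomial.coe_injective (Fin 2) K (by simpa [MvPowerSeries.algebraMap_apply'] using h)

/-- The field of fractions of `K⟦x, y⟧` as an extension of the field `K(x, y)` of rational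
functions, through the inclusion of `K[x, y]` in `K⟦x, y⟧`. -/
noncomputable instance algebra_fractionRing :
    Algebra (FractionRing (MvPolynomial (Fin 2) K)) (FractionRing (MvPowerSeries (Fin 2) K)) :=
  FractionRing.liftAlgebra (MvPolynomial (Fin 2) K) (FractionRing (MvPowerSeries (Fin 2) K))

/-- The power series `G` is algebraic of degree `d` over `K(x, y)`. -/
def IsAlgebraicOfDegree (G : MvPowerSeries (Fin 2) K) (d : ℕ) : Prop :=
  IsAlgebraic (FractionRing (MvPolynomial (Fin 2) K))
      (algebraMap (MvPowerSeries (Fin 2) K) (FractionRing (MvPowerSeries (Fin 2) K)) G) ∧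
    (minpoly (FractionRing (MvPolynomial (Fin 2) K))
      (algebraMap (MvPowerSeries (Fin 2) K)
        (FractionRing (MvPowerSeries (Fin 2) K)) G)).natDegree = d

/-- The equation `x (1 - x) y (1 - y) G ^ 2 - (1 - x) (1 - 2 y) G + 1 = 0`. -/
def QuadraticEq (G : MvPowerSeries (Fin 2) K) : Prop :=
  x K * (1 - x K) * y K * (1 - y K) * G ^ 2 - (1 - x K) * (1 - 2 * y K) * G + 1 = 0

end Series

end WordPatterns

/-! ### Scanning words letter by letter -/

namespace WordPatterns

/-! Read a word from left to right and remember only a state `(a, b)`: letters below `a` do not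
exceed the current minimum, and letters from `b` on would complete a `123`. A letter `c < a` moves
to `(c + 1, b)`, and a letter `a ≤ c < b` to `(a, c + 1)`. Differencing the count `completions` in
`b` and then in `a` gives a local recurrence.

With the states graded by `d = b - a`, it becomes a linear system for the series `stateSeries d`,
with at most one solution by `x`-adic descent. Any power series root `G` of the quadratic yields a
geometric solution `W r ^ d / (1 - y)`, whose term at `d = 0` forces `F = G`. So one argument gives
both that the closed form (a root by the Catalan equation) equals `F` and that the root is unique.

The double sum is the coefficient expansion of the closed form. The degree is 2 because the
discriminant is not a square. -/

theorem contains_p123_iff {α : Type*} [LinearOrder α] {n : ℕ} (w : Fin n → α) :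
    Contains w p123 ↔ ∃ i j l : Fin n, i < j ∧ j < l ∧ w i < w j ∧ w j < w l := by
  constructor
  · rintro ⟨t, ht, h⟩
    refine ⟨t 0, t 1, t 2, ht (by decide), ht (by decide), ?_, ?_⟩
    · have := h 1 0
      simp [p123] at this
      exact this
    · have := h 2 1
      simp [p123] at this
      exact this
  · rintro ⟨i, j, l, hij, hjl, h1, h2⟩
    refine ⟨![i, j, l], ?_, ?_⟩
    · rw [Fin.strictMono_iff_lt_succ]
      intro a
      fin_cases a
      · exact hij
      · exact hjl
    · intro a b
      fin_cases a <;> fin_cases b <;> simp [p123] <;> order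

/-- The word `w` can follow a `123`-avoiding word whose minimal letter is `a - 1` and in which
`b` is the least letter that ends an occurrence of `12`. -/
def IsCompletion (a b : ℕ) {m n : ℕ} (w : Fin n → Fin m) : Prop :=
  ¬ Contains w p123 ∧ (∀ i j, i < j → a ≤ (w i : ℕ) → w j ≤ w i) ∧ ∀ i, (w i : ℕ) < b

/-- If `c < a`, the bound that the new minimum imposes on ascents subsumes the old one. Otherwise
`c` tops a `12`, so later letters are at most `c`, and `c` can no longer start a `123`. -/
theorem isCompletion_cons_iff {a b m n : ℕ} (hab : a ≤ b) (c : Fin m) (w : Fin n → Fin m) :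
    IsCompletion a b (Fin.cons c w : Fin (n + 1) → Fin m) ↔
      if (c : ℕ) < a then IsCompletion (c + 1) b w
      else (c : ℕ) < b ∧ IsCompletion a (c + 1) w := by
  unfold IsCompletion
  simp only [contains_p123_iff, not_exists, not_and, not_lt, Fin.forall_fin_succ, Fin.cons_zero,
    Fin.cons_succ, Fin.succ_lt_succ_iff, Fin.not_lt_zero, Fin.succ_pos, false_imp_iff, true_imp_iff,
    implies_true, true_and]
  simp only [Fin.lt_def, Fin.le_def]
  split_ifs with h
  · constructor
    · rintro ⟨⟨h1, h2⟩, ⟨h3, h4⟩, h5, h6⟩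
      exact ⟨h2, fun i j hij hc => h1 i j hij hc, h6⟩
    · rintro ⟨h1, h2, h3⟩
      exact ⟨⟨fun i j hij hc => h2 i j hij hc, h1⟩,
        ⟨fun j hc => absurd hc (by omega), fun i j hij hi => h2 i j hij (by omega)⟩,
        by omega, h3⟩
  · constructor
    · rintro ⟨⟨h1, h2⟩, ⟨h3, h4⟩, h5, h6⟩
      exact ⟨h5, h2, h4, fun i => by have := h3 i (by omega); omega⟩
    · rintro ⟨h0, h1, h2, h3⟩
      exact ⟨⟨fun i j hij hc => absurd hc (by have := h3 i; omega), h1⟩,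
        ⟨fun j _ => by have := h3 j; omega, h2⟩, h0, fun i => by have := h3 i; omega⟩

/-- The number of completions of length `n` from the state `(a, b)`. -/
def completions : ℕ → ℕ → ℕ → ℕ
  | 0, _, _ => 1
  | n + 1, a, b =>
      ∑ c ∈ Finset.range b, if c < a then completions n (c + 1) b else completions n a (c + 1)

open Classical in
theorem card_isCompletion (m n a b : ℕ) (hab : a ≤ b) (hbm : b ≤ m) :
    (Finset.univ.filter fun w : Fin n → Fin m => IsCompletion a b w).card
      = completions n a b := by
  induction n generalizing a b with
  | zero =>
    have : ∀ w : Fin 0 → Fin m, IsCompletion a b w := fun w =>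
      ⟨by rw [contains_p123_iff]; rintro ⟨i, _⟩; exact i.elim0, fun i => i.elim0, fun i => i.elim0⟩
    simp [this, completions]
  | succ n ih =>
    have key : ∀ c : Fin m, (∑ w : Fin n → Fin m,
        if IsCompletion a b (Fin.cons c w : Fin (n + 1) → Fin m) then 1 else 0) =
        if (c : ℕ) < b then
          if (c : ℕ) < a then completions n (c + 1) b else completions n a (c + 1)
        else 0 := by
      intro c
      simp only [isCompletion_cons_iff hab]
      by_cases h1 : (c : ℕ) < a
      · have h2 : (c : ℕ) < b := by omega
        simp only [h1, h2, if_true, ← Finset.card_filter]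
        exact ih _ _ (by omega) hbm
      · by_cases h2 : (c : ℕ) < b
        · simp only [h1, h2, if_true, if_false, true_and, ← Finset.card_filter]
          exact ih _ _ (by omega) (by omega)
        · simp [h1, h2]
    rw [Finset.card_filter, ← (Fin.consEquiv fun _ => Fin m).sum_comp, Fintype.sum_prod_type]
    refine (Finset.sum_congr rfl fun c _ => key c).trans ?_
    rw [← Finset.sum_range (fun c => if c < b then
          if c < a then completions n (c + 1) b else completions n a (c + 1) else 0),
      ← Finset.sum_filter, completions]
    congr 1
    ext c
    simp only [Finset.mem_filter, Finset.mem_range]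
    omega

theorem ncard_avoiders_p123 (m n : ℕ) : (avoiders m n p123).ncard = completions n m m := by
  classical
  rw [← card_isCompletion m n m m le_rfl le_rfl, ← Set.ncard_coe_finset]
  congr 1
  ext w
  rw [Finset.mem_coe, Finset.mem_filter_univ]
  exact ⟨fun h => ⟨h, fun i j _ hi => absurd hi (by omega), fun i => (w i).2⟩, fun h => h.1⟩

/-! ### Recurrences for the state counts -/

theorem completions_succ {a b : ℕ} (n : ℕ) (hab : a ≤ b) :
    completions (n + 1) a b =
      ∑ c ∈ Finset.range a, completions n (c + 1) b +
        ∑ c ∈ Finset.Ico a b, completions n a (c + 1) := by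
  rw [completions, ← Finset.sum_range_add_sum_Ico _ hab]
  congr 1
  · exact Finset.sum_congr rfl fun c hc => if_pos (Finset.mem_range.1 hc)
  · exact Finset.sum_congr rfl fun c hc => if_neg (Finset.mem_Ico.1 hc).1.not_gt

theorem completions_one_one (n : ℕ) : completions n 1 1 = 1 := by
  induction n with
  | zero => rfl
  | succ n ih => simp [completions_succ n le_rfl, ih]

/-- The letter `a` fixes both states, and every smaller letter sends them to the same state. -/
theorem completions_diag (n a : ℕ) :
    completions n (a + 1) (a + 1) = completions n a (a + 1) := by
  induction n with
  | zero => rfl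
  | succ n ih =>
    rw [completions_succ n le_rfl, completions_succ n a.le_succ]
    simp [Finset.sum_range_succ, ih]

theorem completions_succ_succ_right {a b : ℕ} (n : ℕ) (hab : a ≤ b) :
    completions (n + 1) a (b + 1) + ∑ c ∈ Finset.range a, completions n (c + 1) b =
      completions (n + 1) a b + completions n a (b + 1) +
        ∑ c ∈ Finset.range a, completions n (c + 1) (b + 1) := by
  rw [completions_succ n hab, completions_succ n (by omega : a ≤ b + 1),
    Finset.sum_Ico_succ_top hab]
  ring

/-- The boundary row `a = 0` of the series recurrence: shifts by `x` contribute nothing there,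
whereas `completions n 0 b` need not vanish. -/
theorem completions_one_recurrence {b : ℕ} (n : ℕ) (hb : 1 ≤ b) :
    completions (n + 1) 1 (b + 1) + completions n 1 b =
      completions (n + 1) 1 b + 2 * completions n 1 (b + 1) := by
  have := completions_succ_succ_right n hb
  simp only [Finset.sum_range_one, zero_add] at this
  omega

/-- Differencing `completions_succ_succ_right` in `a` leaves only the last term of each sum. -/
theorem completions_recurrence {a b : ℕ} (n : ℕ) (hab : a + 1 ≤ b) :
    completions (n + 1) (a + 1) (b + 1) + completions (n + 1) a b +
        completions n (a + 1) b + completions n a (b + 1) =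
      completions (n + 1) (a + 1) b + completions (n + 1) a (b + 1) +
        2 * completions n (a + 1) (b + 1) := by
  have h1 := completions_succ_succ_right n hab
  have h2 := completions_succ_succ_right n (by omega : a ≤ b)
  simp only [Finset.sum_range_succ] at h1
  omega

/-! ### Coefficient calculus in two variables -/

section Bivariate

variable (K : Type*) [Field K]

/-- The series `∑ g k n xᵏ yⁿ`. -/
def bivariate (g : ℕ → ℕ → K) : MvPowerSeries (Fin 2) K := fun m => g (m 0) (m 1)

variable {K}

theorem coeff_bivariate (g : ℕ → ℕ → K) (m : Fin 2 →₀ ℕ) :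
    MvPowerSeries.coeff m (bivariate K g) = g (m 0) (m 1) := rfl

theorem bivariate_congr {g h : ℕ → ℕ → K} (H : ∀ k n, g k n = h k n) :
    bivariate K g = bivariate K h := by
  ext m
  exact H _ _

theorem bivariate_add (g h : ℕ → ℕ → K) :
    bivariate K g + bivariate K h = bivariate K fun k n => g k n + h k n := rfl

theorem x_mul_bivariate (g : ℕ → ℕ → K) :
    x K * bivariate K g = bivariate K fun k n => if k = 0 then 0 else g (k - 1) n := by
  ext m
  rw [x, MvPowerSeries.X, MvPowerSeries.coeff_monomial_mul, coeff_bivariate]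
  simp only [Finsupp.single_le_iff, Nat.one_le_iff_ne_zero, coeff_bivariate]
  by_cases h : m 0 = 0 <;> simp [h]

theorem y_mul_bivariate (g : ℕ → ℕ → K) :
    y K * bivariate K g = bivariate K fun k n => if n = 0 then 0 else g k (n - 1) := by
  ext m
  rw [y, MvPowerSeries.X, MvPowerSeries.coeff_monomial_mul, coeff_bivariate]
  simp only [Finsupp.single_le_iff, Nat.one_le_iff_ne_zero, coeff_bivariate]
  by_cases h : m 1 = 0 <;> simp [h]

theorem C_mul_bivariate (c : K) (g : ℕ → ℕ → K) :
    MvPowerSeries.C c * bivariate K g = bivariate K fun k n => c * g k n := by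
  ext m
  simp [coeff_bivariate]

theorem bivariate_sum {ι : Type*} (s : Finset ι) (g : ι → ℕ → ℕ → K) :
    ∑ i ∈ s, bivariate K (g i) = bivariate K fun k n => ∑ i ∈ s, g i k n := by
  ext m
  simp [coeff_bivariate]

theorem one_eq_bivariate :
    (1 : MvPowerSeries (Fin 2) K) = bivariate K fun k n => if k = 0 ∧ n = 0 then 1 else 0 := by
  ext m
  rw [MvPowerSeries.coeff_one, coeff_bivariate]
  congr 1
  simp [Finsupp.ext_iff, Fin.forall_fin_two]

theorem F_eq_bivariate :
    F K = bivariate K fun k n => (completions n (k + 2) (k + 2) : K) := by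
  ext m
  simp only [← ncard_avoiders_p123]
  rfl

theorem x_ne_zero : x K ≠ 0 := fun h => by
  simpa using congrArg (MvPowerSeries.coeff (Finsupp.single 0 1)) h

theorem one_sub_x_ne_zero : (1 - x K) ≠ 0 := fun h => by
  simpa using congrArg MvPowerSeries.constantCoeff h

theorem one_sub_y_mul_inv : (1 - y K) * (1 - y K)⁻¹ = 1 :=
  MvPowerSeries.mul_inv_cancel _ (by simp)

theorem one_sub_two_y_ne_zero : (1 - 2 * y K) ≠ 0 := fun h => by
  simpa using congrArg MvPowerSeries.constantCoeff h

theorem eq_zero_of_forall_x_pow_dvd {φ : MvPowerSeries (Fin 2) K} (h : ∀ N, x K ^ N ∣ φ) :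
    φ = 0 := by
  ext m
  exact MvPowerSeries.X_pow_dvd_iff.1 (h (m 0 + 1)) m (Nat.lt_succ_self _)

end Bivariate

/-! ### The linear system and its geometric solution -/

section LinearSystem

variable {K : Type*} [Field K]

/-- If `x ^ N` divides every `g d`, then `x ^ (N + 1)` divides `g 0`, and, since `1 - 2 y + x` is a
unit, the recurrence carries this to all `d`. -/
theorem eq_zero_of_linear_system (g : ℕ → MvPowerSeries (Fin 2) K)
    (h0 : g 0 = x K * g 1)
    (h : ∀ d, (1 - 2 * y K + x K) * g (d + 1) = (1 - y K) * (x K * g (d + 2) + g d)) (d : ℕ) :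
    g d = 0 := by
  have hu : IsUnit (1 - 2 * y K + x K) := by
    rw [MvPowerSeries.isUnit_iff_constantCoeff]
    simp
  have key : ∀ N d, x K ^ N ∣ g d := by
    intro N
    induction N with
    | zero => simp
    | succ N ihN =>
      intro d
      have hx : ∀ e, x K ^ (N + 1) ∣ x K * g e := fun e => by
        rw [pow_succ']
        exact mul_dvd_mul_left _ (ihN e)
      induction d with
      | zero => exact h0 ▸ hx 1
      | succ d ihd =>
        rw [← hu.dvd_mul_left, h d]
        exact (dvd_add (hx _) ihd).mul_left _
  exact eq_zero_of_forall_x_pow_dvd fun N => key N d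

variable (K) in
/-- The series `∑ completions n (a + 1) (a + 1 + d) xᵃ yⁿ`. -/
def stateSeries (d : ℕ) : MvPowerSeries (Fin 2) K :=
  bivariate K fun a n => (completions n (a + 1) (a + 1 + d) : K)

theorem stateSeries_recurrence (d : ℕ) :
    (1 - 2 * y K + x K) * stateSeries K (d + 1) =
      (1 - y K) * (x K * stateSeries K (d + 2) + stateSeries K d) := by
  have key : stateSeries K (d + 1) + x K * stateSeries K (d + 1) +
        y K * (x K * stateSeries K (d + 2)) + y K * stateSeries K d =
      y K * stateSeries K (d + 1) + y K * stateSeries K (d + 1) +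
        x K * stateSeries K (d + 2) + stateSeries K d := by
    simp only [stateSeries, x_mul_bivariate, y_mul_bivariate, bivariate_add]
    refine bivariate_congr fun a n => ?_
    rcases n with _ | n
    · rcases a with _ | a <;> simp [completions]
    · rcases a with _ | a
      · have := congrArg (Nat.cast : ℕ → K)
          (completions_one_recurrence n (by omega : 1 ≤ d + 1))
        push_cast at this
        simp only [Nat.add_one_ne_zero, if_true, if_false, Nat.add_sub_cancel, zero_add,
          add_zero, Nat.add_comm 1 d, Nat.add_comm 1 (d + 1)]
        linear_combination this
      · have := congrArg (Nat.cast : ℕ → K)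
          (completions_recurrence n (by omega : a + 1 + 1 ≤ a + 1 + 1 + d))
        push_cast at this
        simp only [Nat.add_one_ne_zero, if_false, Nat.add_sub_cancel,
          (by omega : a + 1 + (d + 1) = a + 1 + 1 + d),
          (by omega : a + 1 + (d + 2) = a + 1 + 1 + d + 1),
          (by omega : a + 1 + 1 + (d + 1) = a + 1 + 1 + d + 1)]
        linear_combination this
  linear_combination key

theorem one_sub_y_mul_bivariate :
    (1 - y K) * (bivariate K fun a _ => if a = 0 then 1 else 0) = 1 := by
  have : (bivariate K fun a _ => if a = 0 then 1 else 0) =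
      1 + y K * (bivariate K fun a _ => if a = 0 then 1 else 0) := by
    rw [y_mul_bivariate, one_eq_bivariate, bivariate_add]
    refine bivariate_congr fun a n => ?_
    rcases n with _ | n <;> simp
  linear_combination this

theorem inv_one_sub_y : (1 - y K)⁻¹ = bivariate K fun a _ => if a = 0 then 1 else 0 := by
  linear_combination (bivariate K fun a _ => if a = 0 then 1 else 0) * one_sub_y_mul_inv (K := K) -
    (1 - y K)⁻¹ * one_sub_y_mul_bivariate (K := K)

theorem stateSeries_zero : stateSeries K 0 = (1 - y K)⁻¹ + x K * stateSeries K 1 := by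
  rw [inv_one_sub_y, stateSeries, stateSeries, x_mul_bivariate, bivariate_add]
  refine bivariate_congr fun a n => ?_
  rcases a with _ | a
  · simp [completions_one_one]
  · simp [completions_diag]

theorem stateSeries_zero_eq_F : stateSeries K 0 = (1 - y K)⁻¹ + x K * F K := by
  rw [inv_one_sub_y, stateSeries, F_eq_bivariate, x_mul_bivariate, bivariate_add]
  refine bivariate_congr fun a n => ?_
  rcases a with _ | a
  · simp [completions_one_one]
  · simp

theorem F_eq_of_quadraticEq {G : MvPowerSeries (Fin 2) K} (hG : QuadraticEq K G) : F K = G := by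
  unfold QuadraticEq at hG
  have hy := one_sub_y_mul_inv (K := K)
  -- `W` is what `(1 - y) * stateSeries 0` must be if `F = G`; the ratio `r` below is then forced by
  -- the boundary condition `W (1 - x r) = 1`.
  set W := 1 + (1 - y K) * x K * G with hW
  have hWi : W * W⁻¹ = 1 := MvPowerSeries.mul_inv_cancel _ (by simp [hW])
  set V := W⁻¹
  set r := (1 - y K) * G * V with hr
  -- The characteristic equation of the recurrence in `d`; multiplied by `W ^ 2`, it is a multiple
  -- of the quadratic for `G`.
  have hkernel : (1 - y K) * x K * r ^ 2 - (1 - 2 * y K + x K) * r + (1 - y K) = 0 := by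
    have h1 : (1 - y K) * x K * r ^ 2 - (1 - 2 * y K + x K) * r * (W * V) +
        (1 - y K) * (W * V) ^ 2 = 0 := by
      rw [hr, hW]
      linear_combination (1 - y K) * V ^ 2 * hG
    rw [hWi] at h1
    linear_combination h1
  have h1r : W * (1 - x K * r) = 1 := by
    rw [hr]
    linear_combination hW - (1 - y K) * x K * G * hWi
  have hz := eq_zero_of_linear_system
    (fun d => stateSeries K d - (1 - y K)⁻¹ * W * r ^ d)
    (by
      linear_combination stateSeries_zero (K := K) - (1 - y K)⁻¹ * h1r)
    (fun d => by
      linear_combination stateSeries_recurrence (K := K) d +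
        (1 - y K)⁻¹ * W * r ^ d * hkernel) 0
  refine mul_left_cancel₀ (x_ne_zero (K := K)) ?_
  rw [stateSeries_zero_eq_F] at hz
  linear_combination hz + (1 - y K)⁻¹ * hW + x K * G * hy

end LinearSystem

/-! ### The Catalan closed form and its coefficients -/

section ClosedForm

variable {K : Type*} [Field K]

theorem catalanGF_eq : catalanGF K = 1 + PowerSeries.X * catalanGF K ^ 2 := by
  have h := congrArg (PowerSeries.map (Nat.castRingHom K))
    PowerSeries.catalanSeries_sq_mul_X_add_one
  have hc : PowerSeries.map (Nat.castRingHom K) PowerSeries.catalanSeries = catalanGF K := by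
    ext n
    simp [catalanGF]
  simp only [map_add, map_mul, map_pow, hc, PowerSeries.map_X, map_one] at h
  linear_combination -h

theorem catalanArg_mul :
    catalanArg K * ((1 - x K) * (1 - 2 * y K) ^ 2) = x K * y K * (1 - y K) := by
  rw [catalanArg, mul_assoc, MvPowerSeries.inv_mul_cancel _ (by simp), mul_one]

theorem closedForm_denominator_mul_inv :
    ((1 - x K) * (1 - 2 * y K)) * ((1 - x K) * (1 - 2 * y K))⁻¹ = 1 :=
  MvPowerSeries.mul_inv_cancel _ (by simp)

theorem quadraticEq_closedForm : QuadraticEq K (closedForm K) := by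
  have hS := congrArg (PowerSeries.substAlgHom (R := K) (hasSubst_catalanArg K))
    (catalanGF_eq (K := K))
  rw [map_add, map_mul, map_pow, map_one, PowerSeries.substAlgHom_X,
    PowerSeries.coe_substAlgHom] at hS
  have hu := closedForm_denominator_mul_inv (K := K)
  have ha := catalanArg_mul (K := K)
  unfold QuadraticEq closedForm
  set S := (catalanGF K).subst (catalanArg K)
  set U := ((1 - x K) * (1 - 2 * y K))⁻¹
  have hq : x K * (1 - x K) * y K * (1 - y K) * (U * S) ^ 2 =
      catalanArg K * S ^ 2 * ((1 - x K) * (1 - 2 * y K) * U) ^ 2 := by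
    linear_combination -(1 - x K) * (U * S) ^ 2 * ha
  rw [hq, hu]
  linear_combination -hS - S * hu

theorem F_eq_closedForm : F K = closedForm K :=
  F_eq_of_quadraticEq quadraticEq_closedForm

theorem quadraticEq_iff (G : MvPowerSeries (Fin 2) K) :
    QuadraticEq K G ↔ G = closedForm K :=
  ⟨fun h => (F_eq_of_quadraticEq h).symm.trans F_eq_closedForm,
    fun h => h ▸ quadraticEq_closedForm⟩

/-- Pascal's rule, by induction on `i`; the arbitrary `q` carries the factor in `y`. -/
theorem one_sub_x_pow_mul_bivariate_choose (i : ℕ) (q : ℕ → K) :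
    (1 - x K) ^ (i + 1) * (bivariate K fun k n => (k.choose i : K) * q n) =
      x K ^ i * bivariate K fun k n => if k = 0 then q n else 0 := by
  induction i with
  | zero =>
    have h : (bivariate K fun k n => (k.choose 0 : K) * q n) =
        (bivariate K fun k n => if k = 0 then q n else 0) +
          x K * (bivariate K fun k n => (k.choose 0 : K) * q n) := by
      rw [x_mul_bivariate, bivariate_add]
      refine bivariate_congr fun k n => ?_
      rcases k with _ | k <;> simp
    linear_combination h
  | succ i ih =>
    have h : (bivariate K fun k n => (k.choose (i + 1) : K) * q n) =
        x K * (bivariate K fun k n => (k.choose i : K) * q n) +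
          x K * (bivariate K fun k n => (k.choose (i + 1) : K) * q n) := by
      rw [x_mul_bivariate, x_mul_bivariate, bivariate_add]
      refine bivariate_congr fun k n => ?_
      rcases k with _ | k
      · simp
      · simp [Nat.choose_succ_succ, add_mul]
    linear_combination x K * ih + (1 - x K) ^ (i + 1) * h

variable (K) in
/-- The series `∑ₙ (n choose r) 2ⁿ⁻ʳ yⁿ = yʳ / (1 - 2 y)ʳ⁺¹`. -/
def binomialSeries (r : ℕ) : MvPowerSeries (Fin 2) K :=
  bivariate K fun k n => if k = 0 then 2 ^ (n - r) * (n.choose r : K) else 0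

theorem one_sub_two_y_pow_mul_binomialSeries (r : ℕ) :
    (1 - 2 * y K) ^ (r + 1) * binomialSeries K r = y K ^ r := by
  induction r with
  | zero =>
    have h : binomialSeries K 0 =
        1 + (y K * binomialSeries K 0 + y K * binomialSeries K 0) := by
      rw [binomialSeries, y_mul_bivariate, one_eq_bivariate, bivariate_add, bivariate_add]
      refine bivariate_congr fun k n => ?_
      rcases n with _ | n
      · simp
      · by_cases hk : k = 0
        · simp [hk]
          ring
        · simp [hk]
    linear_combination h
  | succ r ih =>
    have h : binomialSeries K (r + 1) = y K * binomialSeries K r +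
        (y K * binomialSeries K (r + 1) + y K * binomialSeries K (r + 1)) := by
      simp only [binomialSeries, y_mul_bivariate, bivariate_add]
      refine bivariate_congr fun k n => ?_
      by_cases hk : k = 0
      · rcases n with _ | n
        · simp [hk]
        · simp only [hk, if_true, Nat.add_one_ne_zero, if_false, Nat.add_sub_cancel,
            Nat.add_sub_add_right, Nat.choose_succ_succ]
          rcases lt_or_ge r n with hr | hr
          · obtain ⟨e, rfl⟩ := Nat.exists_eq_add_of_lt hr
            simp only [(by omega : r + e + 1 - r = e + 1), (by omega : r + e + 1 - (r + 1) = e)]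
            push_cast
            ring
          · simp [Nat.choose_eq_zero_of_lt (by omega : n < r + 1)]
      · simp [hk]
    linear_combination y K * ih + (1 - 2 * y K) ^ (r + 1) * h

/-- Substitute `r = i + j`; both ranges are first enlarged by vanishing terms so that they match. -/
theorem sum_choose_sub_eq {R : Type*} [CommRing R] (i n : ℕ) :
    (∑ r ∈ Finset.range (n + 1),
      2 ^ (n - r) * ((if i ≤ r then i.choose (r - i) else 0 : ℕ) : R) * (n.choose r : R)) =
    ∑ j ∈ Finset.range (i + 1),
      (i.choose j : R) * (2 ^ (n - (i + j)) * (n.choose (i + j) : R)) := by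
  have h1 : ∀ f : ℕ → R, (∀ r, n < r → f r = 0) →
      ∑ r ∈ Finset.range (n + 1), f r = ∑ r ∈ Finset.range (i + (n + i + 1)), f r := by
    intro f hf
    refine Finset.sum_subset (Finset.range_subset_range.2 (by omega)) fun r _ hr => hf r ?_
    simpa [Nat.lt_succ_iff] using hr
  have h2 : ∀ f : ℕ → R, (∀ j, i < j → f j = 0) →
      ∑ j ∈ Finset.range (i + 1), f j = ∑ j ∈ Finset.range (n + i + 1), f j := by
    intro f hf
    refine Finset.sum_subset (Finset.range_subset_range.2 (by omega)) fun r _ hr => hf r ?_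
    simpa [Nat.lt_succ_iff] using hr
  rw [h1 _ fun r hr => by simp [Nat.choose_eq_zero_of_lt hr],
    h2 _ fun j hj => by simp [Nat.choose_eq_zero_of_lt hj], Finset.sum_range_add,
    Finset.sum_eq_zero, zero_add]
  · refine Finset.sum_congr rfl fun j _ => ?_
    simp
    ring
  · intro r hr
    simp [(Finset.mem_range.1 hr).not_ge]

theorem inv_mul_catalanArg_pow (i : ℕ) :
    ((1 - x K) * (1 - 2 * y K))⁻¹ * catalanArg K ^ i =
      bivariate K fun k n => (k.choose i : K) * ∑ r ∈ Finset.range (n + 1),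
        2 ^ (n - r) * ((if i ≤ r then i.choose (r - i) else 0 : ℕ) : K) * (n.choose r : K) := by
  have hu := closedForm_denominator_mul_inv (K := K)
  have ha := congrArg (· ^ i) (catalanArg_mul (K := K))
  simp only [mul_pow, ← pow_mul] at ha
  have hQ : (1 - 2 * y K) ^ (2 * i + 1) * (∑ j ∈ Finset.range (i + 1),
      MvPowerSeries.C (i.choose j : K) * binomialSeries K (i + j)) =
      y K ^ i * (1 - y K) ^ i := by
    -- Writing `1 - y` as `y + (1 - 2 y)` makes each binomial term a `binomialSeries` after division
    -- by `(1 - 2 y) ^ (2 i + 1)`.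
    have hb : (1 - y K) ^ i = (y K + (1 - 2 * y K)) ^ i := by ring
    rw [hb, add_pow, Finset.mul_sum, Finset.mul_sum]
    refine Finset.sum_congr rfl fun j hj => ?_
    obtain ⟨e, rfl⟩ := Nat.exists_eq_add_of_le (Nat.lt_succ_iff.1 (Finset.mem_range.1 hj))
    have hT := one_sub_two_y_pow_mul_binomialSeries (K := K) (j + e + j)
    rw [Nat.add_sub_cancel_left, map_natCast,
      (by ring : 2 * (j + e) + 1 = e + (j + e + j + 1)), pow_add]
    linear_combination (1 - 2 * y K) ^ e * ((j + e).choose j : MvPowerSeries (Fin 2) K) * hT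
  have hne : (1 - x K) ^ (i + 1) * (1 - 2 * y K) ^ (2 * i + 1) ≠ 0 :=
    mul_ne_zero (pow_ne_zero _ one_sub_x_ne_zero) (pow_ne_zero _ one_sub_two_y_ne_zero)
  refine mul_left_cancel₀ hne ?_
  simp only [sum_choose_sub_eq]
  have hP := one_sub_x_pow_mul_bivariate_choose i fun n => ∑ j ∈ Finset.range (i + 1),
      (i.choose j : K) * (2 ^ (n - (i + j)) * (n.choose (i + j) : K))
  have hB : (bivariate K fun k n => if k = 0 then ∑ j ∈ Finset.range (i + 1),
      (i.choose j : K) * (2 ^ (n - (i + j)) * (n.choose (i + j) : K)) else 0) =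
      ∑ j ∈ Finset.range (i + 1),
        MvPowerSeries.C (i.choose j : K) * binomialSeries K (i + j) := by
    simp only [binomialSeries, C_mul_bivariate, bivariate_sum]
    refine bivariate_congr fun k n => ?_
    split_ifs <;> simp
  rw [hB] at hP
  linear_combination ha + catalanArg K ^ i * (1 - x K) ^ i * (1 - 2 * y K) ^ (2 * i) * hu -
    (1 - 2 * y K) ^ (2 * i + 1) * hP - x K ^ i * hQ

theorem coeff_closedForm (m : Fin 2 →₀ ℕ) :
    MvPowerSeries.coeff m (closedForm K) =
      ∑ r ∈ Finset.range (m 1 + 1), ∑ i ∈ Finset.range (m 0 + 1),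
        2 ^ (m 1 - r) * (catalan i : K) * ((if i ≤ r then i.choose (r - i) else 0 : ℕ) : K)
          * ((m 1).choose r : K) * ((m 0).choose i : K) := by
  -- Since `x` divides `catalanArg`, Catalan terms of index above `m 0` cannot reach the monomial
  -- `m`.
  have hS := congrArg (PowerSeries.substAlgHom (R := K) (hasSubst_catalanArg K))
    ((catalanGF K).eq_X_pow_mul_shift_add_trunc (m 0 + 1))
  rw [map_add, map_mul, map_pow, PowerSeries.substAlgHom_X, PowerSeries.coe_substAlgHom,
    PowerSeries.subst_coe (hasSubst_catalanArg K)] at hS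
  rw [closedForm, hS, mul_add, map_add, MvPowerSeries.X_pow_dvd_iff.1 _ m (Nat.lt_succ_self (m 0)),
    zero_add, Finset.sum_comm]
  · simp only [PowerSeries.trunc_apply, Nat.Ico_zero_eq_range, map_sum,
      Polynomial.aeval_monomial, Finset.mul_sum]
    refine Finset.sum_congr rfl fun i _ => ?_
    have h := congrArg (MvPowerSeries.coeff m) (inv_mul_catalanArg_pow (K := K) i)
    rw [coeff_bivariate] at h
    rw [mul_left_comm]
    simp only [MvPowerSeries.algebraMap_apply, Algebra.algebraMap_self, RingHom.id_apply,
      MvPowerSeries.coeff_C_mul, h, catalanGF, PowerSeries.coeff_mk, Finset.mul_sum]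
    exact Finset.sum_congr rfl fun r _ => by ring
  · refine (Dvd.dvd.mul_right (pow_dvd_pow_of_dvd ?_ _) _).mul_left _
    exact (((dvd_refl _).mul_right _).mul_right _).mul_right _

theorem ncard_avoiders_eq_sum (n k : ℕ) :
    (avoiders (k + 2) n p123).ncard =
      ∑ r ∈ Finset.range (n + 1), ∑ i ∈ Finset.range (k + 1),
        2 ^ (n - r) * catalan i * (if i ≤ r then i.choose (r - i) else 0)
          * n.choose r * k.choose i := by
  have h := coeff_closedForm (K := ℚ) (Finsupp.single 0 k + Finsupp.single 1 n)
  rw [← F_eq_closedForm, F_eq_bivariate, coeff_bivariate] at h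
  have h0 : (Finsupp.single 0 k + Finsupp.single 1 n : Fin 2 →₀ ℕ) 0 = k := by simp
  have h1 : (Finsupp.single 0 k + Finsupp.single 1 n : Fin 2 →₀ ℕ) 1 = n := by simp
  rw [h0, h1] at h
  rw [ncard_avoiders_p123]
  exact_mod_cast h

end ClosedForm

/-! ### Degree two over the rational functions -/

section Algebraic

variable {K : Type*} [Field K] [CharZero K]

theorem sq_ne_discriminant (P : MvPolynomial (Fin 2) K) :
    P ^ 2 ≠ (1 - MvPolynomial.X 0) * ((1 - 2 * MvPolynomial.X 1) ^ 2 - MvPolynomial.X 0) := by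
  intro h
  -- At `y = 1/2` the right side becomes `-x (1 - x)`, which `x` divides exactly once.
  have h2 := congrArg
    (MvPolynomial.aeval ![(Polynomial.X : Polynomial K), Polynomial.C (2⁻¹ : K)]) h
  have h3 : (2 : Polynomial K) * Polynomial.C (2⁻¹ : K) = 1 := by
    rw [← Polynomial.C_ofNat, ← Polynomial.C_mul]
    simp
  simp [h3] at h2
  set p := MvPolynomial.aeval ![(Polynomial.X : Polynomial K), Polynomial.C (2⁻¹ : K)] P
  have hd : (Polynomial.X : Polynomial K) ∣ p :=
    Polynomial.prime_X.dvd_of_dvd_pow (n := 2) ⟨-(1 - Polynomial.X), by rw [h2]; ring⟩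
  obtain ⟨s, hs⟩ := hd
  rw [hs] at h2
  have h5 : Polynomial.X * s ^ 2 = -(1 - Polynomial.X) := by
    refine mul_left_cancel₀ (Polynomial.X_ne_zero (R := K)) ?_
    linear_combination h2
  simpa using congrArg (Polynomial.eval 0) h5

/-- A root in `L` would make the discriminant a square in `L`; its square root is integral over `R`,
hence lies in `R`. -/
theorem natDegree_minpoly_eq_two {R L M : Type*} [CommRing R] [IsDomain R] [IsIntegrallyClosed R]
    [Field L] [Algebra R L] [IsFractionRing R L] [Field M] [Algebra L M] {A B : R} (hA : A ≠ 0)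
    (hsq : ∀ P : R, P ^ 2 ≠ B ^ 2 - 4 * A) {φ : M}
    (hroot : algebraMap L M (algebraMap R L A) * φ ^ 2 -
      algebraMap L M (algebraMap R L B) * φ + 1 = 0) :
    IsAlgebraic L φ ∧ (minpoly L φ).natDegree = 2 := by
  have ha0 : algebraMap R L A ≠ 0 := (map_ne_zero_iff _ (IsFractionRing.injective R L)).2 hA
  set q : Polynomial L := Polynomial.C (algebraMap R L A) * Polynomial.X ^ 2 +
    Polynomial.C (-algebraMap R L B) * Polynomial.X + Polynomial.C 1 with hq
  have hqdeg : q.natDegree = 2 := Polynomial.natDegree_quadratic ha0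
  have hq0 : q ≠ 0 := fun h => by simp [h] at hqdeg
  have hqroot : Polynomial.aeval φ q = 0 := by
    rw [← hroot, hq]
    simp [sub_eq_add_neg]
  have halg : IsAlgebraic L φ := ⟨q, hq0, hqroot⟩
  refine ⟨halg, le_antisymm ?_ ?_⟩
  · exact (Polynomial.natDegree_le_of_dvd (minpoly.dvd L φ hqroot) hq0).trans_eq hqdeg
  · refine Nat.succ_le_of_lt (lt_of_le_of_ne (minpoly.natDegree_pos halg.isIntegral) fun h1 => ?_)
    obtain ⟨s, hs⟩ := minpoly.natDegree_eq_one_iff.1 h1.symm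
    have hs2 : algebraMap R L A * s ^ 2 - algebraMap R L B * s + 1 = 0 := by
      apply (algebraMap L M).injective
      rw [map_zero, ← hroot, ← hs]
      simp
    have hD : (2 * algebraMap R L A * s - algebraMap R L B) ^ 2 =
        algebraMap R L (B ^ 2 - 4 * A) := by
      rw [map_sub, map_pow, map_mul, map_ofNat]
      linear_combination 4 * algebraMap R L A * hs2
    obtain ⟨P, hP⟩ := IsIntegrallyClosed.exists_algebraMap_eq_of_isIntegral_pow (R := R) (K := L)
      two_pos (hD ▸ isIntegral_algebraMap)
    rw [← hP, ← map_pow] at hD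
    exact hsq P (IsFractionRing.injective R L hD)

instance isScalarTower_fractionRing :
    IsScalarTower (MvPolynomial (Fin 2) K) (FractionRing (MvPolynomial (Fin 2) K))
      (FractionRing (MvPowerSeries (Fin 2) K)) :=
  FractionRing.isScalarTower_liftAlgebra _ _

theorem isAlgebraicOfDegree_two {G : MvPowerSeries (Fin 2) K} (hG : QuadraticEq K G) :
    IsAlgebraicOfDegree K G 2 := by
  refine natDegree_minpoly_eq_two (R := MvPolynomial (Fin 2) K)
    (A := MvPolynomial.X 0 * (1 - MvPolynomial.X 0) * MvPolynomial.X 1 * (1 - MvPolynomial.X 1))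
    (B := (1 - MvPolynomial.X 0) * (1 - 2 * MvPolynomial.X 1)) ?_ ?_ ?_
  · intro h
    have h2 := congrArg (MvPolynomial.aeval fun _ => (2 : K)) h
    norm_num at h2
  · intro P hP
    refine sq_ne_discriminant P (hP.trans ?_)
    ring
  · have hcoe : ∀ p : MvPolynomial (Fin 2) K,
        algebraMap (FractionRing (MvPolynomial (Fin 2) K))
          (FractionRing (MvPowerSeries (Fin 2) K)) (algebraMap _ _ p) =
        algebraMap (MvPowerSeries (Fin 2) K) (FractionRing (MvPowerSeries (Fin 2) K))
          (MvPolynomial.coeToMvPowerSeries.ringHom p) := by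
      intro p
      rw [← IsScalarTower.algebraMap_apply (MvPolynomial (Fin 2) K),
        IsScalarTower.algebraMap_apply (MvPolynomial (Fin 2) K) (MvPowerSeries (Fin 2) K),
        MvPowerSeries.algebraMap_apply']
      simp
    rw [hcoe, hcoe]
    have h := congrArg
      (algebraMap (MvPowerSeries (Fin 2) K) (FractionRing (MvPowerSeries (Fin 2) K))) hG
    simpa only [map_add, map_sub, map_mul, map_pow, map_one, map_zero, map_ofNat,
      MvPolynomial.coeToMvPowerSeries.ringHom_apply, MvPolynomial.coe_X] using h

end Algebraic

end WordPatterns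

theorem theorem4p6 :
    (∀ n k : ℕ,
      (WordPatterns.avoiders (k + 2) n WordPatterns.p123).ncard =
        ∑ r ∈ Finset.range (n + 1), ∑ i ∈ Finset.range (k + 1),
          2 ^ (n - r) * catalan i * (if i ≤ r then i.choose (r - i) else 0)
            * n.choose r * k.choose i) ∧
    (∀ (K : Type*) [Field K] [CharZero K],
      WordPatterns.F K = WordPatterns.closedForm K ∧
      WordPatterns.IsAlgebraicOfDegree K (WordPatterns.F K) 2 ∧
      WordPatterns.QuadraticEq K (WordPatterns.F K) ∧
      ∀ G : MvPowerSeries (Fin 2) K,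
        WordPatterns.QuadraticEq K G ↔ G = WordPatterns.closedForm K) :=
  ⟨WordPatterns.ncard_avoiders_eq_sum, fun K _ _ =>
    ⟨WordPatterns.F_eq_closedForm,
      WordPatterns.isAlgebraicOfDegree_two
        ((WordPatterns.quadraticEq_iff _).2 WordPatterns.F_eq_closedForm),
      (WordPatterns.quadraticEq_iff _).2 WordPatterns.F_eq_closedForm,
      WordPatterns.quadraticEq_iff⟩⟩
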